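/- All rings are associative with identity and not necessarily commutative; $U(R)$ denotes the group of units of $R$. Let $R$ be a ring and $\alpha : R\to R$ a (unital) ring endomorphism. Put $\Delta(R)=\{a\in R : 1-ua\in U(R) \text{ for all } u\in U(R)\}$, let $Nil_*(R)$ be the prime radical of $R$ (the intersection of all prime ideals of $R$), and let $R[x;\alpha]$ be the skew polynomial ring over $R$, with multiplication determined by $xr=\alpha(r)x$ for $r\in R$. Suppose that $R$ is $2$-primal, i.e. $Nil_*(R)$ is exactly the set of nilpotent elements of $R$, and $\alpha$-compatible, i.e. for all $a,b\in R$ one has $ab=0$ if and only if $a\alpha(b)=0$. Then $$\Delta(R[x;\alpha])=\Delta(R)+Nil_*(R[x;\alpha])\,x=\{a+gx : a\in\Delta(R),\ g\in Nil_*(R[x;\alpha])\},$$ where $R$ is identified with the constant polynomials. -/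

import Mathlib

namespace DeltaRing

section General

variable (R : Type*) [Ring R]

/-- `Δ(R)`: the elements `a` such that `1 - u * a` is a unit for every unit `u`. -/
def delta : Set R := {a | ∀ u : R, IsUnit u → IsUnit (1 - u * a)}

variable {R} in
/-- Prime two-sided ideals of a not necessarily commutative ring: proper, and
`a R b ⊆ P` implies `a ∈ P` or `b ∈ P`. -/
def IsPrimeIdeal (P : TwoSidedIdeal R) : Prop :=
  P ≠ ⊤ ∧ ∀ a b : R, (∀ r : R, a * r * b ∈ P) → a ∈ P ∨ b ∈ P

/-- The prime radical (lower nilradical) `Nil_*(R)`: the intersection of all prime ideals. -/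
def primeRadical : TwoSidedIdeal R := sInf {P | IsPrimeIdeal P}

/-- `R` is 2-primal: its prime radical consists precisely of the nilpotent elements. -/
def IsTwoPrimal : Prop := ∀ a : R, a ∈ primeRadical R ↔ IsNilpotent a

variable {R} in
/-- `R` is `α`-compatible: `a * b = 0` if and only if `a * α b = 0`. -/
def IsCompatible (α : R →+* R) : Prop := ∀ a b : R, a * b = 0 ↔ a * α b = 0

end General

noncomputable section Skew

variable {R : Type*} [Ring R]

/-- The action of `ℕ` on `R` by the iterates of the endomorphism `α`. -/
@[reducible] def endAction (α : R →+* R) : MulSemiringAction (Multiplicative ℕ) R where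
  smul n r := (α ^ n.toAdd) r
  one_smul _ := rfl
  mul_smul m n r := by
    change (α ^ (m.toAdd + n.toAdd)) r = (α ^ m.toAdd) ((α ^ n.toAdd) r)
    rw [pow_add]; rfl
  smul_zero _ := map_zero _
  smul_add _ _ _ := map_add _ _ _
  smul_one _ := map_one _
  smul_mul _ _ _ := map_mul _ _ _

/-- The skew polynomial ring `R[x; α]`: Mathlib's skew polynomials, for the action of `ℕ` on `R`
given by the endomorphism `α`. -/
def SkewPoly (_α : R →+* R) : Type _ := SkewPolynomial R

namespace SkewPoly

variable (α : R →+* R)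

instance : Ring (SkewPoly α) :=
  letI := endAction α
  inferInstanceAs (Ring (SkewMonoidAlgebra R (Multiplicative ℕ)))

/-- The embedding of `R` into `R[x; α]` as the constant polynomials. -/
def C : R →+* SkewPoly α :=
  letI := endAction α
  SkewPolynomial.CRingHom

/-- The indeterminate `x`. -/
def X : SkewPoly α := SkewPolynomial.X (R := R)

/-- The defining commutation rule `x r = α(r) x`. -/
theorem X_mul_C (r : R) : X α * C α r = C α (α r) * X α := by
  let := endAction α
  have h : (SkewPolynomial.X : SkewPolynomial R) * SkewPolynomial.C r
      = SkewPolynomial.C (α r) * SkewPolynomial.X := by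
    rw [SkewPolynomial.X_mul, SkewPolynomial.sum_C_index (by simp)]
    rfl
  exact h

end SkewPoly

end Skew

end DeltaRing

/-!
Write `N` for the prime radical of `R` and `S = R[x; α]`. The theorem rests on two facts.

* The coefficients of positive degree of a unit of `S` lie in `N`
  (`SkewPoly.coeff_mem_primeRadical_of_isUnit`). If `f g = 1`, the convolution sums
  `∑ aᵢ αⁱ(bⱼ)` vanish in positive degree, and a double induction as for reduced Armendariz rings,
  carried out modulo `N`, gives `aᵢ bⱼ ∈ N` for `i + j ≥ 1`. As `b₀` is a unit, `aᵢ ∈ N` for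
  `i ≥ 1`.
* `N` is contained in the prime radical of `S` (`SkewPoly.C_mem_primeRadical`). Compatibility implies
  that `α` can be inserted into or deleted from any product without affecting whether the product
  is zero. Thus, for a prime ideal `P` of `S`, the elements of `R` which have the same vanishing
  products as some `b ∈ R` outside `P` form an m-system avoiding `0`, and Krull's separation lemma
  gives a prime ideal of `R` disjoint from it.

Hence every unit of `S` is `u₀ + h x` with `u₀` a unit of `R` and `h` in the prime radical of `S`,
which consists of nilpotent elements; subtracting an element of the prime radical therefore does
not change whether an element is a unit. So for `a ∈ Δ(R)` and `g` in the prime radical of `S`,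
`1 - u (a + g x)` is a unit, since it differs from the unit `1 - u₀ a` by an element of the prime
radical. Conversely, if `f ∈ Δ(S)`, the two facts applied to the unit `1 - f` give the shape
`f = f₀ + g x`, and the constant coefficients of the units `1 - u f`, for `u` a unit of `R`, give
`f₀ ∈ Δ(R)`.
-/

namespace DeltaRing

open Finset.HasAntidiagonal (antidiagonal mem_antidiagonal)

/-! ### Prime ideals and the prime radical -/

section PrimeRadical

variable {R : Type*} [Ring R]

/-- Krull's separation lemma for noncommutative rings: an ideal maximal among those disjoint from
an m-system is prime. -/
theorem exists_isPrimeIdeal_disjoint {M : Set R} (hne : M.Nonempty) (h0 : (0 : R) ∉ M)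
    (hM : ∀ a ∈ M, ∀ b ∈ M, ∃ r, a * r * b ∈ M) :
    ∃ P : TwoSidedIdeal R, IsPrimeIdeal P ∧ ∀ a ∈ M, a ∉ P := by
  obtain ⟨P, hP⟩ : ∃ P, Maximal (fun I : TwoSidedIdeal R ↦ ∀ a ∈ M, a ∉ I) P := by
    refine zorn_le₀ {I : TwoSidedIdeal R | ∀ a ∈ M, a ∉ I} fun c hc hchain ↦ ?_
    rcases c.eq_empty_or_nonempty with rfl | ⟨I₀, hI₀⟩
    · exact ⟨⊥, fun a ha h ↦ h0 ((TwoSidedIdeal.mem_bot R).1 h ▸ ha), by simp⟩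
    · let J : TwoSidedIdeal R := .mk' {x | ∃ I ∈ c, x ∈ I} ⟨I₀, hI₀, I₀.zero_mem⟩
        (by
          rintro x y ⟨I, hI, hx⟩ ⟨I', hI', hy⟩
          rcases hchain.total hI hI' with h | h
          · exact ⟨I', hI', I'.add_mem (h hx) hy⟩
          · exact ⟨I, hI, I.add_mem hx (h hy)⟩)
        (by rintro x ⟨I, hI, hx⟩; exact ⟨I, hI, I.neg_mem hx⟩)
        (by rintro x y ⟨I, hI, hy⟩; exact ⟨I, hI, I.mul_mem_left _ _ hy⟩)
        (by rintro x y ⟨I, hI, hx⟩; exact ⟨I, hI, I.mul_mem_right _ _ hx⟩)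
      have hJ (x : R) : x ∈ J ↔ ∃ I ∈ c, x ∈ I := TwoSidedIdeal.mem_mk' ..
      refine ⟨J, fun a ha h ↦ ?_, fun I hI x hx ↦ (hJ x).2 ⟨I, hI, hx⟩⟩
      obtain ⟨I, hI, h⟩ := (hJ a).1 h
      exact hc hI a ha h
  -- By maximality, the ideal generated by `P` and an element outside `P` meets `M`.
  have key (a : R) (ha : a ∉ P) : ∃ m ∈ M, m ∈ P ⊔ TwoSidedIdeal.span {a} := by
    by_contra! h
    have := hP.2 (y := P ⊔ TwoSidedIdeal.span {a}) (fun m hm ↦ h m hm) le_sup_left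
    exact ha (this (TwoSidedIdeal.mem_sup_right (TwoSidedIdeal.subset_span rfl)))
  refine ⟨P, ⟨?_, fun a b hab ↦ ?_⟩, hP.1⟩
  · rintro rfl
    obtain ⟨m, hm⟩ := hne
    exact hP.1 m hm (TwoSidedIdeal.mem_top R)
  · by_contra! h
    obtain ⟨m, hm, hma⟩ := key a h.1
    obtain ⟨n, hn, hnb⟩ := key b h.2
    obtain ⟨r, hr⟩ := hM m hm n hn
    refine hP.1 _ hr ?_
    -- It suffices that `(a) R (b) ⊆ P`; this is checked on one generator at a time.
    have h1 (y : R) (hy : y ∈ TwoSidedIdeal.span {b}) : ∀ s, a * s * y ∈ P := by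
      induction hy using TwoSidedIdeal.span_induction with
      | mem x hx => rw [Set.mem_singleton_iff.1 hx]; exact hab
      | zero => intro s; rw [mul_zero]; exact P.zero_mem
      | add x y _ _ hx hy => intro s; rw [mul_add]; exact P.add_mem (hx s) (hy s)
      | neg x _ hx => intro s; rw [mul_neg]; exact P.neg_mem (hx s)
      | left_absorb t x _ hx =>
        intro s; rw [← mul_assoc, mul_assoc a]; exact hx _
      | right_absorb t x _ hx =>
        intro s; rw [← mul_assoc]; exact P.mul_mem_right _ _ (hx s)
    have h2 (x : R) (hx : x ∈ TwoSidedIdeal.span {a}) :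
        ∀ s, ∀ y ∈ TwoSidedIdeal.span {b}, x * s * y ∈ P := by
      induction hx using TwoSidedIdeal.span_induction with
      | mem x hx => rw [Set.mem_singleton_iff.1 hx]; exact fun s y hy ↦ h1 y hy s
      | zero => intro s y _; rw [zero_mul, zero_mul]; exact P.zero_mem
      | add x x' _ _ hx hx' =>
        intro s y hy; rw [add_mul, add_mul]; exact P.add_mem (hx s y hy) (hx' s y hy)
      | neg x _ hx => intro s y hy; rw [neg_mul, neg_mul]; exact P.neg_mem (hx s y hy)
      | left_absorb t x _ hx =>
        intro s y hy; rw [mul_assoc, mul_assoc, ← mul_assoc x]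
        exact P.mul_mem_left _ _ (hx s y hy)
      | right_absorb t x _ hx => intro s y hy; rw [mul_assoc x]; exact hx _ y hy
    obtain ⟨p, hp, x, hx, rfl⟩ := TwoSidedIdeal.mem_sup.1 hma
    obtain ⟨q, hq, y, hy, rfl⟩ := TwoSidedIdeal.mem_sup.1 hnb
    rw [mul_add, add_mul, add_mul, add_mul]
    exact P.add_mem (P.add_mem (P.mul_mem_left _ _ hq) (P.mul_mem_left _ _ hq))
      (P.add_mem (P.mul_mem_right _ _ (P.mul_mem_right _ _ hp)) (h2 x hx r y hy))

theorem isNilpotent_of_mem_primeRadical {a : R} (ha : a ∈ primeRadical R) : IsNilpotent a := by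
  by_contra h
  obtain ⟨P, hP, hPa⟩ := exists_isPrimeIdeal_disjoint (M := {b | ∃ n : ℕ, b = a ^ n})
    ⟨a, 1, (pow_one a).symm⟩ (fun ⟨n, hn⟩ ↦ h ⟨n, hn.symm⟩)
    (by rintro _ ⟨m, rfl⟩ _ ⟨n, rfl⟩; exact ⟨1, m + n, by rw [mul_one, pow_add]⟩)
  exact hPa a ⟨1, (pow_one a).symm⟩ ((TwoSidedIdeal.mem_sInf _).1 ha P hP)

/-- The prime radical is nil, hence contained in the Jacobson radical. -/
theorem isUnit_sub_of_mem_primeRadical {v h : R} (hv : IsUnit v) (hh : h ∈ primeRadical R) :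
    IsUnit (v - h) := by
  obtain ⟨v, rfl⟩ := hv
  have := v.isUnit.mul (isNilpotent_of_mem_primeRadical
    ((primeRadical R).mul_mem_left ↑v⁻¹ h hh)).isUnit_one_sub
  rwa [mul_sub, mul_one, Units.mul_inv_cancel_left] at this

theorem isNilpotent_mul_comm {a b : R} (h : IsNilpotent (a * b)) : IsNilpotent (b * a) := by
  obtain ⟨n, hn⟩ := h
  exact ⟨n + 1, by rw [pow_succ, ← mul_assoc, mul_pow_mul, hn, mul_zero, zero_mul]⟩

theorem IsTwoPrimal.mul_mem_comm (h2 : IsTwoPrimal R) {a b : R} (h : a * b ∈ primeRadical R) :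
    b * a ∈ primeRadical R :=
  (h2 _).2 (isNilpotent_mul_comm ((h2 _).1 h))

end PrimeRadical

/-! ### Compatible endomorphisms -/

section Compatible

variable {R : Type*} [Ring R]

/-- Two elements are annihilator equivalent if replacing one by the other as a factor of a product
does not change whether that product vanishes. -/
def AnnEquiv (b c : R) : Prop := ∀ x y : R, x * b * y = 0 ↔ x * c * y = 0

namespace AnnEquiv

theorem refl (b : R) : AnnEquiv b b := fun _ _ ↦ Iff.rfl

theorem mul {b c b' c' : R} (h : AnnEquiv b c) (h' : AnnEquiv b' c') :
    AnnEquiv (b * b') (c * c') := fun x y ↦ by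
  rw [← mul_assoc, ← mul_assoc, h', mul_assoc (x * b), h, mul_assoc (x * c)]

theorem pow {b c : R} (h : AnnEquiv b c) (n : ℕ) : AnnEquiv (b ^ n) (c ^ n) := by
  induction n with
  | zero => simpa using refl 1
  | succ n ih => simpa [pow_succ] using ih.mul h

theorem eq_zero_iff {b c : R} (h : AnnEquiv b c) : b = 0 ↔ c = 0 := by
  simpa using h 1 1

theorem mem_primeRadical_iff (h2 : IsTwoPrimal R) {b c : R} (h : AnnEquiv b c) :
    b ∈ primeRadical R ↔ c ∈ primeRadical R := by
  rw [h2, h2]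
  exact exists_congr fun n ↦ (h.pow n).eq_zero_iff

end AnnEquiv

theorem IsCompatible.annEquiv {α : R →+* R} (hα : IsCompatible α) (b : R) :
    AnnEquiv (α b) b := fun x y ↦ by
  rw [hα, mul_assoc, ← map_mul, ← hα, mul_assoc]

theorem IsCompatible.annEquiv_pow {α : R →+* R} (hα : IsCompatible α) (n : ℕ) (b : R) :
    AnnEquiv ((α ^ n) b) b := by
  induction n with
  | zero => exact .refl b
  | succ n ih =>
    rw [pow_succ']
    exact fun x y ↦ (hα.annEquiv ((α ^ n) b) x y).trans (ih x y)

/-- A skew Armendariz property modulo the prime radical. The sequences `a` and `b`, both eventually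
zero, stand for the coefficients of two skew polynomials whose product is constant. -/
theorem mul_mem_primeRadical_of_convolution_eq_zero {α : R →+* R} (h2 : IsTwoPrimal R)
    (hα : IsCompatible α) {a b : ℕ → R}
    (hab : ∀ k, 1 ≤ k → ∑ p ∈ antidiagonal k, a p.1 * (α ^ p.1) (b p.2) = 0)
    {m n : ℕ} (ha : ∀ i, m ≤ i → a i = 0) (hb : ∀ j, n ≤ j → b j = 0) (i j : ℕ)
    (hij : 1 ≤ i + j) : a i * b j ∈ primeRadical R := by
  have hα' (c d e : R) (i : ℕ) :
      c * (α ^ i) d * e ∈ primeRadical R ↔ c * d * e ∈ primeRadical R :=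
    AnnEquiv.mem_primeRadical_iff h2 (((AnnEquiv.refl c).mul (hα.annEquiv_pow i d)).mul (.refl e))
  -- Downward induction on the total degree `i + j`, then upward induction on `i`.
  induction hd : m + n - (i + j) using Nat.strong_induction_on generalizing i j with
  | _ d ihd =>
  subst hd
  induction i using Nat.strong_induction_on generalizing j with
  | _ i ihi =>
  by_cases hlarge : m + n ≤ i + j
  · rcases le_or_gt m i with h | h
    · rw [ha i h, zero_mul]; exact TwoSidedIdeal.zero_mem _
    · rw [hb j (by omega), mul_zero]; exact TwoSidedIdeal.zero_mem _
  have hmem : (i, j) ∈ antidiagonal (i + j) := by simp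
  have hsum := hab _ hij
  rw [← Finset.add_sum_erase _ _ hmem] at hsum
  have hrest : b j * ∑ p ∈ (antidiagonal (i + j)).erase (i, j),
      a p.1 * (α ^ p.1) (b p.2) ∈ primeRadical R := by
    rw [Finset.mul_sum]
    refine sum_mem fun p hp ↦ ?_
    obtain ⟨hne, hp⟩ := Finset.mem_erase.1 hp
    rw [mem_antidiagonal] at hp
    rcases lt_trichotomy p.1 i with h | h | h
    -- For `p.1 < i` the factor `a p.1 * b p.2` is covered by the inner induction.
    · refine TwoSidedIdeal.mul_mem_left _ _ _ ?_
      have := ihi p.1 h p.2 (by omega) (by rwa [hp])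
      simpa using (hα' (a p.1) (b p.2) 1 p.1).2 (by simpa using this)
    · exact absurd (Prod.ext h (by simp; omega)) hne
    -- For `p.1 > i` the product `a p.1 * b j` has larger total degree.
    · rw [← mul_assoc]
      refine TwoSidedIdeal.mul_mem_right _ _ _ (h2.mul_mem_comm ?_)
      exact ihd _ (by omega) p.1 j (by omega) rfl
  -- Multiplied by `b j` on the left, every term of the sum other than the one at `(i, j)` lies in
  -- the prime radical, hence so does that one.
  have hlead : b j * (a i * (α ^ i) (b j)) ∈ primeRadical R := by
    rw [eq_neg_of_add_eq_zero_left hsum, mul_neg]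
    exact TwoSidedIdeal.neg_mem _ hrest
  have hsq : (b j * a i) * b j * a i ∈ primeRadical R := by
    rw [← hα' _ _ _ i, mul_assoc (b j)]
    exact TwoSidedIdeal.mul_mem_right _ _ _ hlead
  refine h2.mul_mem_comm ((h2 _).2 ?_)
  obtain ⟨k, hk⟩ := (h2 _).1 hsq
  exact ⟨2 * k, by rw [pow_mul, pow_two, ← mul_assoc, hk]⟩

end Compatible

/-! ### Skew polynomials over compatible 2-primal rings -/

namespace SkewPoly

variable {R : Type*} [Ring R] (α : R →+* R)

/-- The coefficient of `x ^ n`. -/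
def coeff (n : ℕ) : SkewPoly α →+ R where
  toFun f := SkewPolynomial.coeff f n
  map_zero' := rfl
  map_add' f g := by
    have h := SkewMonoidAlgebra.coeff_add (k := R) (G := Multiplicative ℕ) f g
    exact DFunLike.congr_fun h (Multiplicative.ofAdd n)

variable {α}

theorem C_mul_X_pow_eq_monomial (a : R) (n : ℕ) :
    C α a * X α ^ n = (SkewPolynomial.monomial n a : SkewPolynomial R) :=
  @SkewPolynomial.C_mul_X_pow_eq_monomial R _ a (endAction α) n

theorem coeff_C_mul_X_pow (a : R) (n k : ℕ) :
    coeff α k (C α a * X α ^ n) = if n = k then a else 0 := by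
  rw [C_mul_X_pow_eq_monomial]
  exact SkewPolynomial.coeff_monomial

theorem coeff_C (a : R) (k : ℕ) : coeff α k (C α a) = if 0 = k then a else 0 := by
  simpa using coeff_C_mul_X_pow (α := α) a 0 k

theorem coeff_one (k : ℕ) : coeff α k 1 = if 0 = k then 1 else 0 := by
  rw [← map_one (C α), coeff_C]

theorem exists_eq_sum (f : SkewPoly α) :
    ∃ n, (∀ i, n ≤ i → coeff α i f = 0) ∧
      f = ∑ i ∈ Finset.range n, C α (coeff α i f) * X α ^ i := by
  let s := SkewPolynomial.support (R := R) f
  have hs (i : ℕ) (hi : i ∉ s) : coeff α i f = 0 := SkewPolynomial.notMem_support_iff.1 hi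
  refine ⟨s.sup id + 1, fun i hi ↦ hs i fun h ↦ ?_, ?_⟩
  · have := Finset.le_sup (f := id) h
    simp only [id] at this
    omega
  · have h1 : f = ∑ i ∈ s, C α (coeff α i f) * X α ^ i := by
      simp_rw [C_mul_X_pow_eq_monomial]
      refine ((SkewPolynomial.sum_monomial (R := R) f).symm.trans (SkewPolynomial.sum_def f _))
    conv_lhs => rw [h1]
    refine Finset.sum_subset (fun i hi ↦ ?_) fun i _ hi ↦ ?_
    · have := Finset.le_sup (f := id) hi
      simp only [id] at this
      simp; omega
    · rw [hs i hi, map_zero, zero_mul]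

theorem induction_on {p : SkewPoly α → Prop} (f : SkewPoly α)
    (add : ∀ f g, p f → p g → p (f + g)) (monomial : ∀ a n, p (C α a * X α ^ n)) : p f := by
  obtain ⟨n, -, h⟩ := exists_eq_sum f
  rw [h]
  exact Finset.sum_induction _ p add (by simpa using monomial 0 0) fun i _ ↦ monomial _ _

theorem X_pow_mul_C (n : ℕ) (r : R) : X α ^ n * C α r = C α ((α ^ n) r) * X α ^ n := by
  induction n with
  | zero => simp
  | succ n ih =>
    rw [pow_succ' (X α), mul_assoc, ih, ← mul_assoc, X_mul_C, mul_assoc, pow_succ' α]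
    rfl

theorem C_mul_X_pow_mul_C_mul_X_pow (a b : R) (m n : ℕ) :
    C α a * X α ^ m * (C α b * X α ^ n) = C α (a * (α ^ m) b) * X α ^ (m + n) := by
  rw [mul_assoc, ← mul_assoc (X α ^ m), X_pow_mul_C, map_mul, pow_add]
  simp only [mul_assoc]

theorem coeff_mul (f g : SkewPoly α) (k : ℕ) :
    coeff α k (f * g) =
      ∑ p ∈ antidiagonal k, coeff α p.1 f * (α ^ p.1) (coeff α p.2 g) := by
  induction f using induction_on with
  | add f f' hf hf' => simp only [add_mul, map_add, hf, hf', Finset.sum_add_distrib]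
  | monomial a m =>
  induction g using induction_on with
  | add g g' hg hg' => simp only [mul_add, map_add, hg, hg', Finset.sum_add_distrib]
  | monomial b n =>
  simp only [C_mul_X_pow_mul_C_mul_X_pow, coeff_C_mul_X_pow]
  split_ifs with h
  · rw [Finset.sum_eq_single (m, n)]
    · simp
    · rintro p hp hne
      by_cases h1 : m = p.1
      · rw [if_neg (c := n = p.2) fun h2 ↦ hne (Prod.ext h1.symm h2.symm), map_zero, mul_zero]
      · rw [if_neg h1, zero_mul]
    · simp [h]
  · refine (Finset.sum_eq_zero fun p hp ↦ ?_).symm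
    rw [mem_antidiagonal] at hp
    by_cases h1 : m = p.1
    · rw [if_neg (c := n = p.2) (by omega), map_zero, mul_zero]
    · rw [if_neg h1, zero_mul]

theorem isUnit_coeff_zero {f : SkewPoly α} (hf : IsUnit f) : IsUnit (coeff α 0 f) := by
  obtain ⟨u, rfl⟩ := hf
  have h1 := congr_arg (coeff α 0) u.mul_inv
  have h2 := congr_arg (coeff α 0) u.inv_mul
  simp only [coeff_mul, coeff_one, Finset.Nat.antidiagonal_zero, Finset.sum_singleton, pow_zero,
    RingHom.one_def, RingHom.id_apply, if_true] at h1 h2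
  exact ⟨⟨_, _, h1, h2⟩, rfl⟩

/-- Over a compatible 2-primal ring, the units of `R[x; α]` are constant modulo the prime radical
of `R`. -/
theorem coeff_mem_primeRadical_of_isUnit (h2 : IsTwoPrimal R) (hα : IsCompatible α)
    {f : SkewPoly α} (hf : IsUnit f) {i : ℕ} (hi : 1 ≤ i) : coeff α i f ∈ primeRadical R := by
  obtain ⟨u, rfl⟩ := hf
  obtain ⟨m, hm, -⟩ := exists_eq_sum (u : SkewPoly α)
  obtain ⟨n, hn, -⟩ := exists_eq_sum (↑u⁻¹ : SkewPoly α)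
  have hk := mul_mem_primeRadical_of_convolution_eq_zero h2 hα (a := fun i ↦ coeff α i ↑u)
    (b := fun j ↦ coeff α j ↑u⁻¹)
    (fun k hk ↦ by rw [← coeff_mul, u.mul_inv, coeff_one, if_neg (by omega)]) hm hn i 0 hi
  have h0 := congr_arg (coeff α 0) u.inv_mul
  simp only [coeff_mul, coeff_one, Finset.Nat.antidiagonal_zero, Finset.sum_singleton, pow_zero,
    RingHom.one_def, RingHom.id_apply, if_true] at h0
  have := TwoSidedIdeal.mul_mem_right _ _ (coeff α 0 ↑u) hk
  rwa [mul_assoc, h0, mul_one] at this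

/-- The constants of a prime ideal of `R[x; α]` need not form a prime ideal of `R`, so the proof
uses the m-system of all elements annihilator equivalent to a constant outside the ideal. -/
theorem C_mem_primeRadical (hα : IsCompatible α) {a : R} (ha : a ∈ primeRadical R) :
    C α a ∈ primeRadical (SkewPoly α) := by
  refine (TwoSidedIdeal.mem_sInf _).2 fun P hP ↦ ?_
  by_contra haP
  obtain ⟨Q, hQ, hQM⟩ := exists_isPrimeIdeal_disjoint
    (M := {c : R | ∃ b, C α b ∉ P ∧ AnnEquiv b c}) ⟨a, a, haP, .refl a⟩
    (by
      rintro ⟨b, hb, hbc⟩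
      rw [hbc.eq_zero_iff.2 rfl, map_zero] at hb
      exact hb P.zero_mem)
    (by
      rintro c ⟨b, hb, hbc⟩ c' ⟨b', hb', hbc'⟩
      obtain ⟨s, hs⟩ : ∃ s, C α b * s * C α b' ∉ P := by
        by_contra! h
        exact (hP.2 _ _ h).elim hb hb'
      -- Some monomial `r x ^ n` of `s` already satisfies `b r x ^ n b' ∉ P`.
      obtain ⟨r, n, hr⟩ : ∃ r n, C α b * (C α r * X α ^ n) * C α b' ∉ P := by
        by_contra! h
        refine hs (induction_on (p := fun s ↦ C α b * s * C α b' ∈ P) s (fun f g hf hg ↦ ?_) h)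
        rw [mul_add, add_mul]
        exact P.add_mem hf hg
      refine ⟨r, b * r * (α ^ n) b', fun h ↦ hr ?_,
        (hbc.mul (.refl r)).mul fun x y ↦ (hα.annEquiv_pow n b' x y).trans (hbc' x y)⟩
      rw [mul_assoc, mul_assoc (C α r), X_pow_mul_C, ← mul_assoc, ← mul_assoc, ← map_mul,
        ← map_mul]
      exact P.mul_mem_right _ _ h)
  exact hQM a ⟨a, haP, .refl a⟩ ((TwoSidedIdeal.mem_sInf _).1 ha Q hQ)

theorem exists_eq_C_add_mul_X (hα : IsCompatible α) {f : SkewPoly α}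
    (hf : ∀ i, 1 ≤ i → coeff α i f ∈ primeRadical R) :
    ∃ g ∈ primeRadical (SkewPoly α), f = C α (coeff α 0 f) + g * X α := by
  obtain ⟨n, hn, h⟩ := exists_eq_sum f
  refine ⟨∑ i ∈ Finset.range n, C α (coeff α (i + 1) f) * X α ^ i, sum_mem fun i _ ↦
    TwoSidedIdeal.mul_mem_right _ _ _ (C_mem_primeRadical hα (hf _ (by omega))), ?_⟩
  have h' : f = ∑ i ∈ Finset.range (n + 1), C α (coeff α i f) * X α ^ i := by
    rw [Finset.sum_range_succ, ← h, hn n le_rfl, map_zero, zero_mul, add_zero]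
  conv_lhs => rw [h', Finset.sum_range_succ', pow_zero, mul_one, add_comm]
  simp only [Finset.sum_mul, mul_assoc, pow_succ]

end SkewPoly

end DeltaRing

open DeltaRing SkewPoly in
theorem mainTheorem6 {R : Type*} [Ring R] (α : R →+* R)
    (h2 : DeltaRing.IsTwoPrimal R) (hα : DeltaRing.IsCompatible α) :
    DeltaRing.delta (DeltaRing.SkewPoly α) =
      {f | ∃ a ∈ DeltaRing.delta R, ∃ g ∈ DeltaRing.primeRadical (DeltaRing.SkewPoly α),
        f = DeltaRing.SkewPoly.C α a + g * DeltaRing.SkewPoly.X α} := by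
  ext f
  constructor
  · intro hf
    obtain ⟨g, hg, hfg⟩ := exists_eq_C_add_mul_X (f := f) hα fun i hi ↦ by
      have := coeff_mem_primeRadical_of_isUnit h2 hα (hf 1 isUnit_one) hi
      rw [one_mul, map_sub, coeff_one, if_neg (by omega), zero_sub] at this
      simpa using TwoSidedIdeal.neg_mem _ this
    refine ⟨_, fun u hu ↦ ?_, g, hg, hfg⟩
    have := isUnit_coeff_zero (hf (C α u) (hu.map (C α)))
    simpa [coeff_mul, coeff_one, coeff_C] using this
  · rintro ⟨a, ha, g, hg, rfl⟩ u hu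
    obtain ⟨h, hh, hu'⟩ := exists_eq_C_add_mul_X hα fun i hi ↦
      coeff_mem_primeRadical_of_isUnit h2 hα hu hi
    have h0 := (ha _ (isUnit_coeff_zero hu)).map (C α)
    -- `1 - u (a + g x) = (1 - u₀ a) - (h x a + u g x)`, where `u = u₀ + h x`.
    have key := isUnit_sub_of_mem_primeRadical h0 (TwoSidedIdeal.add_mem _
      (TwoSidedIdeal.mul_mem_right _ _ (C α a) (TwoSidedIdeal.mul_mem_right _ _ (X α) hh))
      (TwoSidedIdeal.mul_mem_left _ u _ (TwoSidedIdeal.mul_mem_right _ _ (X α) hg)))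
    convert key using 1
    rw [mul_add u]
    nth_rewrite 1 [hu']
    rw [map_sub, map_one, map_mul, add_mul]
    abel
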